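/- Let $m,c,\alpha,T>0$ and consider the planar relativistic Kepler problem $$\frac{d}{dt}\left(\frac{m\dot x}{\sqrt{1-|\dot x|^2/c^2}}\right)=-\alpha\frac{x}{|x|^3},\qquad x\in\mathbb R^2\setminus\{0\},$$ which is the Euler--Lagrange equation of $\mathcal L(x,\dot x)=mc^2\bigl(1-\sqrt{1-|\dot x|^2/c^2}\bigr)+\alpha/|x|$. For integers $k\ge 1$ let $$u^k_n=\frac{n k^3}{(k^2-n^2)^{3/2}}\cdot\frac{2\pi\alpha}{mc^3}\quad (0\le n\le k-1),\qquad u^k_k=+\infty .$$ Let $\Lambda_k$ be the set of $T$-periodic loops in $\mathbb R^2\setminus\{0\}$ with winding number $$\frac1{2\pi}\int_0^T\frac{x_u\dot x_v-x_v\dot x_u}{x_u^2+x_v^2}\,dt=k$$ around the origin, where $x=(x_u,x_v)$. Let $k\ge1$ and let $i_T\in\{0,\dots,k-1\}$ satisfy $u^k_{i_T}<T\le u^k_{i_T+1}$. Then the problem has a circular $T$-periodic solution in $\Lambda_k$ (a $T$-periodic solution of constant modulus $|x|$), and every such solution $x_C$ has Morse index equal to $2i_T$. Here the Morse index of $x_C$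 is the index (the supremum of the dimensions of the linear subspaces on which the form is negative definite) of the second variation $$\tau_C(q)=\int_0^T\Bigl(\tfrac12\langle A(t)\dot q,\dot q\rangle+\tfrac12\langle B(t)q,q\rangle\Bigr)dt,\qquad q\in H^1_T,$$ where $H^1_T$ is the space of $T$-periodic functions $q:\mathbb R\to\mathbb R^2$ that are absolutely continuous on $[0,T]$ with $\dot q\in L^2(0,T)$, and $A(t)=\partial^2_{\dot x\dot x}\mathcal L$, $B(t)=\partial^2_{xx}\mathcal L$ along $x_C$, that is, $$A(t)=\frac m{c^2}\Bigl(1-\tfrac{|\dot x_C|^2}{c^2}\Bigr)^{-3/2}\dot x_C\otimes\dot x_C+m\Bigl(1-\tfrac{|\dot x_C|^2}{c^2}\Bigr)^{-1/2}\mathrm{Id},\qquad B(t)=\frac{3\alpha}{|x_C|^5}\,x_C\otimes x_C-\frac{\alpha}{|x_C|^3}\,\mathrm{Id}.$$ -/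

import Mathlib

open MeasureTheory Set
open scoped ENNReal

/-! The plane is `ℂ` with its real inner product. -/

namespace RelKepler

noncomputable section

/-- The Lorentz factor `(1 - |v|² / c²)^(-1/2)`. -/
def lorentz (c : ℝ) (v : ℂ) : ℝ := (√(1 - ‖v‖ ^ 2 / c ^ 2))⁻¹

/-- The Lagrangian `m c² (1 - √(1 - |v|² / c²)) + α / |x|`. -/
def lagrangian (m c α : ℝ) (x v : ℂ) : ℝ :=
  m * c ^ 2 * (1 - √(1 - ‖v‖ ^ 2 / c ^ 2)) + α / ‖x‖

/-- `x : ℝ → ℝ² \ {0}` is a (classical, global) solution of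
`d/dt (m x' / √(1 - |x'|² / c²)) = - α x / |x|³`. -/
structure IsSolution (m c α : ℝ) (x : ℝ → ℂ) : Prop where
  differentiable : Differentiable ℝ x
  ne_zero : ∀ t, x t ≠ 0
  speed_lt : ∀ t, ‖deriv x t‖ < c
  eqn : ∀ t, HasDerivAt (fun s => (m * lorentz c (deriv x s)) • deriv x s)
    (-(α / ‖x t‖ ^ 3) • x t) t

/-- The winding number around the origin of a `T`-periodic path `x`, as the integral
`(1 / 2π) ∫₀ᵀ (x_u x_v' - x_v x_u') / |x|² dt`. -/
def windingNumber (T : ℝ) (x : ℝ → ℂ) : ℝ :=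
  1 / (2 * Real.pi) * ∫ t in (0 : ℝ)..T,
    ((x t).re * (deriv x t).im - (x t).im * (deriv x t).re) / ((x t).re ^ 2 + (x t).im ^ 2)

/-- `x` is a circular `T`-periodic solution with winding number `k`. -/
structure IsCircularSolution (m c α T : ℝ) (k : ℕ) (x : ℝ → ℂ) : Prop where
  isSolution : IsSolution m c α x
  periodic : Function.Periodic x T
  circular : ∃ R : ℝ, ∀ t, ‖x t‖ = R
  winding : windingNumber T x = k

/-- The thresholds `u^k_n = n k³ / (k² - n²)^(3/2) * (2 π α / (m c³))` for `n < k`, and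
`u^k_k = +∞`. -/
def threshold (m c α : ℝ) (k n : ℕ) : EReal :=
  if n < k then
    (((n : ℝ) * (k : ℝ) ^ 3 / ((k : ℝ) ^ 2 - (n : ℝ) ^ 2) ^ (3 / 2 : ℝ)
      * (2 * Real.pi * α / (m * c ^ 3)) : ℝ) : EReal)
  else ⊤

/-- The Hessian of the Lagrangian with respect to the velocity, at velocity `v`, applied to `w`. -/
def hessVel (m c : ℝ) (v w : ℂ) : ℂ :=
  (m / c ^ 2 * lorentz c v ^ 3 * inner ℝ v w) • v + (m * lorentz c v) • w

/-- The Hessian of the Lagrangian with respect to the position, at position `x`, applied to `u`. -/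
def hessPos (α : ℝ) (x u : ℂ) : ℂ :=
  (3 * α / ‖x‖ ^ 5 * inner ℝ x u) • x - (α / ‖x‖ ^ 3) • u

/-- The space `H¹_T` of (continuous representatives of) `T`-periodic functions which are
absolutely continuous on `[0, T]` with derivative in `L²(0, T)`. -/
def H1T (T : ℝ) : Submodule ℝ (ℝ → ℂ) where
  carrier := {q | Function.Periodic q T ∧ AbsolutelyContinuousOnInterval q 0 T ∧
    MemLp (deriv q) 2 (volume.restrict (uIoc 0 T))}
  zero_mem' := by
    refine ⟨fun t => rfl, ?_, ?_⟩
    · exact (contDiff_const (c := (0 : ℂ))).contDiffOn.absolutelyContinuousOnInterval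
    · have : deriv (0 : ℝ → ℂ) = 0 := by
        funext t
        exact deriv_const t (0 : ℂ)
      rw [this]
      exact MemLp.zero
  add_mem' := by
    rintro p q ⟨hp, hp', hp''⟩ ⟨hq, hq', hq''⟩
    refine ⟨hp.add hq, hp'.add hq', (hp''.add hq'').ae_eq ?_⟩
    rw [Filter.EventuallyEq, ae_restrict_iff' measurableSet_uIoc]
    filter_upwards [hp'.boundedVariationOn.ae_differentiableAt_of_mem_uIcc,
      hq'.boundedVariationOn.ae_differentiableAt_of_mem_uIcc] with t h₁ h₂ ht
    have ht' := uIoc_subset_uIcc ht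
    exact (deriv_add (h₁ ht') (h₂ ht')).symm
  smul_mem' := by
    rintro a q ⟨hq, hq', hq''⟩
    refine ⟨fun t => by simp [hq t], hq'.const_smul a, ?_⟩
    have : deriv (a • q) = a • deriv q := by
      funext t
      exact deriv_const_smul_field a q
    rw [this]
    exact hq''.const_smul a

/-- The quadratic form `q ↦ ∫₀ᵀ (½ ⟨A(t) q', q'⟩ + ½ ⟨B(t) q, q⟩) dt` on `H¹_T`, where `A(t)` and
`B(t)` are the Hessians of the Lagrangian along `x` with respect to velocity and position. -/
def secondVariation (m c α T : ℝ) (x : ℝ → ℂ) (q : H1T T) : ℝ :=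
  ∫ t in (0 : ℝ)..T,
    (1 / 2 * inner ℝ (hessVel m c (deriv x t) (deriv q.1 t)) (deriv q.1 t)
      + 1 / 2 * inner ℝ (hessPos α (x t) (q.1 t)) (q.1 t))

/-- The Morse index of a function (a quadratic form) `Q` on a real vector space: the supremum of the
dimensions of the subspaces on which `Q` is negative definite. -/
def morseIndex {V : Type*} [AddCommGroup V] [Module ℝ V] (Q : V → ℝ) : ℕ∞ :=
  ⨆ W : {W : Submodule ℝ V // ∀ q ∈ W, q ≠ 0 → Q q < 0}, Cardinal.toENat (Module.rank ℝ W.1)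

/-- The Morse index of `x` as a `T`-periodic solution. -/
def orbitIndex (m c α T : ℝ) (x : ℝ → ℂ) : ℕ∞ := morseIndex (secondVariation m c α T x)

private lemma normSq_line (x u : ℂ) (s : ℝ) :
    ‖x + s • u‖ ^ 2 = ‖x‖ ^ 2 + 2 * inner ℝ x u * s + ‖u‖ ^ 2 * s ^ 2 := by
  rw [norm_add_sq_real, inner_smul_right, norm_smul, mul_pow, Real.norm_eq_abs, sq_abs]
  ring

/-- `hessVel` and `hessPos` are indeed the blocks of the second derivative of the Lagrangian (the
mixed block vanishes). -/
theorem lagrangian_second_derivative (m c α : ℝ) (hc : 0 < c) (x v u w : ℂ) (hx : x ≠ 0)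
    (hv : ‖v‖ < c) :
    iteratedDeriv 2 (fun s : ℝ => lagrangian m c α (x + s • u) (v + s • w)) 0
      = inner ℝ (hessVel m c v w) w + inner ℝ (hessPos α x u) u := by
  set a := ‖x‖ ^ 2 with ha
  set b := inner ℝ x u with hb
  set d := ‖u‖ ^ 2 with hd
  set e := inner ℝ v w with he
  set g := ‖w‖ ^ 2 with hg
  let P : ℝ → ℝ := fun s => 1 - (‖v‖ ^ 2 + 2 * e * s + g * s ^ 2) / c ^ 2
  let P' : ℝ → ℝ := fun s => -(2 * e + 2 * g * s) / c ^ 2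
  let Q : ℝ → ℝ := fun s => a + 2 * b * s + d * s ^ 2
  let Q' : ℝ → ℝ := fun s => 2 * b + 2 * d * s
  have hP : ∀ s, HasDerivAt P (P' s) s := by
    intro s
    have h := ((((hasDerivAt_id s).const_mul (2 * e)).const_add (‖v‖ ^ 2)).add
      (((hasDerivAt_id s).pow 2).const_mul g)).div_const (c ^ 2) |>.const_sub 1
    refine (h.congr_deriv ?_)
    simp [P']
    ring
  have hQ : ∀ s, HasDerivAt Q (Q' s) s := by
    intro s
    have h := (((hasDerivAt_id s).const_mul (2 * b)).const_add a).add
      (((hasDerivAt_id s).pow 2).const_mul d)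
    refine (h.congr_deriv ?_)
    simp [Q']
    ring
  have hP' : ∀ s, HasDerivAt P' (-(2 * g) / c ^ 2) s := by
    intro s
    have h := (((hasDerivAt_id s).const_mul (2 * g)).const_add (2 * e)).neg.div_const (c ^ 2)
    refine (h.congr_deriv ?_)
    simp
  have hQ' : ∀ s, HasDerivAt Q' (2 * d) s := by
    intro s
    have h := ((hasDerivAt_id s).const_mul (2 * d)).const_add (2 * b)
    refine (h.congr_deriv ?_)
    simp
  have hf : (fun s : ℝ => lagrangian m c α (x + s • u) (v + s • w))
      = fun s => m * c ^ 2 * (1 - √(P s)) + α / √(Q s) := by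
    funext s
    have h1 : ‖x + s • u‖ = √(Q s) := by
      rw [← Real.sqrt_sq (norm_nonneg (x + s • u)), normSq_line]
    simp only [lagrangian, h1, normSq_line, P]
    rfl
  have hP0 : 0 < P 0 := by
    have : ‖v‖ ^ 2 < c ^ 2 := pow_lt_pow_left₀ hv (norm_nonneg v) two_ne_zero
    have h2 : ‖v‖ ^ 2 / c ^ 2 < 1 := (div_lt_one (by positivity)).2 this
    simp [P]
    linarith
  have hQ0 : 0 < Q 0 := by
    have := norm_pos_iff.2 hx
    simp [Q, ha]
    positivity
  have hder : deriv (fun s => m * c ^ 2 * (1 - √(P s)) + α / √(Q s)) =ᶠ[nhds 0]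
      fun s => -(m * c ^ 2 / 2) * (P' s / √(P s)) - α / 2 * (Q' s / (Q s * √(Q s))) := by
    filter_upwards [(hP 0).continuousAt.eventually (lt_mem_nhds hP0),
      (hQ 0).continuousAt.eventually (lt_mem_nhds hQ0)] with s h1 h2
    have hs1 : √(P s) ≠ 0 := (Real.sqrt_pos.2 h1).ne'
    have hs2 : √(Q s) ≠ 0 := (Real.sqrt_pos.2 h2).ne'
    have h := ((((hP s).sqrt h1.ne').const_sub 1).const_mul (m * c ^ 2)).add
      ((hasDerivAt_const s α).div ((hQ s).sqrt h2.ne') hs2)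
    refine (h.congr_deriv ?_).deriv
    rw [Real.sq_sqrt h2.le]
    field_simp
    ring
  have hs1 : √(P 0) ≠ 0 := (Real.sqrt_pos.2 hP0).ne'
  have hs2 : √(Q 0) ≠ 0 := (Real.sqrt_pos.2 hQ0).ne'
  have hq : √(Q 0) = ‖x‖ := by
    simp [Q, ha]
  have hp : lorentz c v = (√(P 0))⁻¹ := by
    simp [P, lorentz]
  have hPs : P 0 = √(P 0) ^ 2 := (Real.sq_sqrt hP0.le).symm
  have hQs : Q 0 = √(Q 0) ^ 2 := (Real.sq_sqrt hQ0.le).symm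
  rw [hf, iteratedDeriv_succ, iteratedDeriv_one, hder.deriv_eq]
  have h := (((hP' 0).div ((hP 0).sqrt hP0.ne') hs1).const_mul (-(m * c ^ 2 / 2))).sub
    (((hQ' 0).div ((hQ 0).mul ((hQ 0).sqrt hQ0.ne')) (mul_ne_zero hQ0.ne' hs2)).const_mul (α / 2))
  refine h.deriv.trans ?_
  simp only [hessVel, hessPos, inner_add_left, inner_sub_left, real_inner_smul_left,
    real_inner_self_eq_norm_sq, ← hb, ← hd, ← he, ← hg, hp, ← hq]
  have e1 : P' 0 = -(2 * e) / c ^ 2 := by simp [P']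
  have e2 : Q' 0 = 2 * b := by simp [Q']
  simp only [Pi.mul_apply, e1, e2]
  clear_value P Q P' Q' a b d e g
  generalize √(P 0) = p at *
  generalize √(Q 0) = r at *
  rw [hQs]
  field_simp
  ring

end

end RelKepler

/-!
A circular solution rotates uniformly, `x t = R e(t)` with `e` a unit vector turning at the angular
velocity `w = 2 π k / T` (`IsCircularSolution.exists_frame`): the momentum is orthogonal to the
central force, so the speed is constant, hence so is the angular momentum, and the winding number
fixes its value. Writing `G` for the Lorentz factor, the equation of motion becomes
`m G w² R³ = α`, which is solvable for every `w > 0` (`exists_isOrbitRadius`).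

In the rotating frame, `q = e (f + i g)` with `f` radial and `g` tangential, and the second variation
has constant coefficients. After discarding the null Lagrangian `(f g)'` and completing the square
it is (`secondVariation_circular`)
`(m G / 2) ∫ (G² (g' + K f)² + f'² - (w / G)² f²)`, with `K = w (G² + 1) / G²`.
A Fourier mode `n ≥ 1` of `f` can be balanced by `g` so that the square vanishes, and then
contributes with the sign of `(2 π n / T)² - (w / G)²`. The mean of `f` cannot be balanced, as `g'` has
mean zero, and its contribution is nonnegative because `G² K² ≥ (w / G)²`. So the index is twice
the number of `n ≥ 1` with `n < k / G` (`orbitIndex_circular`): the variations `trigVariation`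
span a negative subspace of that dimension, and the form is nonnegative where the corresponding
Fourier coefficients `radialCoeffs` of `f` vanish, by Parseval's identity (`hasSum_wirtinger`).

Finally, `n G < k` means that `T` exceeds the `n`-th threshold (`threshold_lt_iff`).
-/

/-! ### Absolutely continuous paths in the plane -/

theorem LipschitzWith.comp_absolutelyContinuousOnInterval {X Y : Type*} [PseudoMetricSpace X]
    [PseudoMetricSpace Y] {K : NNReal} {g : X → Y} {f : ℝ → X} {a b : ℝ} (hg : LipschitzWith K g)
    (hf : AbsolutelyContinuousOnInterval f a b) :
    AbsolutelyContinuousOnInterval (fun t => g (f t)) a b := by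
  unfold AbsolutelyContinuousOnInterval at hf ⊢
  refine squeeze_zero (fun E => Finset.sum_nonneg fun _ _ => dist_nonneg) (fun E => ?_)
    (by simpa using hf.const_mul (K : ℝ))
  rw [Finset.mul_sum]
  exact Finset.sum_le_sum fun i _ => hg.dist_le_mul _ _

namespace RelKepler

variable {a b T : ℝ}

theorem absolutelyContinuous_re {f : ℝ → ℂ} (hf : AbsolutelyContinuousOnInterval f a b) :
    AbsolutelyContinuousOnInterval (fun t => (f t).re) a b :=
  Complex.reCLM.lipschitz.comp_absolutelyContinuousOnInterval hf

theorem absolutelyContinuous_im {f : ℝ → ℂ} (hf : AbsolutelyContinuousOnInterval f a b) :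
    AbsolutelyContinuousOnInterval (fun t => (f t).im) a b :=
  Complex.imCLM.lipschitz.comp_absolutelyContinuousOnInterval hf

theorem absolutelyContinuous_ofReal {f : ℝ → ℝ} (hf : AbsolutelyContinuousOnInterval f a b) :
    AbsolutelyContinuousOnInterval (fun t => (f t : ℂ)) a b :=
  Complex.ofRealCLM.lipschitz.comp_absolutelyContinuousOnInterval hf

theorem ae_differentiableAt_complex {f : ℝ → ℂ} (hf : AbsolutelyContinuousOnInterval f a b) :
    ∀ᵐ t ∂volume.restrict (uIoc a b), DifferentiableAt ℝ f t := by
  rw [ae_restrict_iff' measurableSet_uIoc]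
  filter_upwards [hf.boundedVariationOn.ae_differentiableAt_of_mem_uIcc] with t h ht
  exact h (uIoc_subset_uIcc ht)

theorem ae_differentiableAt_real {f : ℝ → ℝ} (hf : AbsolutelyContinuousOnInterval f a b) :
    ∀ᵐ t ∂volume.restrict (uIoc a b), DifferentiableAt ℝ f t := by
  rw [ae_restrict_iff' measurableSet_uIoc]
  filter_upwards [hf.boundedVariationOn.ae_differentiableAt_of_mem_uIcc] with t h ht
  exact h (uIoc_subset_uIcc ht)

theorem hasDerivAt_re {f : ℝ → ℂ} {f' : ℂ} {t : ℝ} (h : HasDerivAt f f' t) :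
    HasDerivAt (fun s => (f s).re) f'.re t :=
  Complex.reCLM.hasFDerivAt.comp_hasDerivAt t h

theorem hasDerivAt_im {f : ℝ → ℂ} {f' : ℂ} {t : ℝ} (h : HasDerivAt f f' t) :
    HasDerivAt (fun s => (f s).im) f'.im t :=
  Complex.imCLM.hasFDerivAt.comp_hasDerivAt t h

/-- The fundamental theorem of calculus for absolutely continuous paths in the plane. -/
theorem integral_deriv_eq_sub_complex {f : ℝ → ℂ} (hf : AbsolutelyContinuousOnInterval f a b) :
    ∫ t in a..b, deriv f t = f b - f a := by
  have hre := absolutelyContinuous_re hf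
  have him := absolutelyContinuous_im hf
  have key : ∫ t in a..b, deriv f t
      = ∫ t in a..b, (((deriv (fun s => (f s).re) t : ℝ) : ℂ)
        + ((deriv (fun s => (f s).im) t : ℝ) : ℂ) * Complex.I) := by
    refine intervalIntegral.integral_congr_ae_restrict ?_
    filter_upwards [ae_differentiableAt_complex hf] with t ht
    rw [(hasDerivAt_re ht.hasDerivAt).deriv, (hasDerivAt_im ht.hasDerivAt).deriv, Complex.re_add_im]
  have i1 : IntervalIntegrable (fun t => ((deriv (fun s => (f s).re) t : ℝ) : ℂ)) volume a b :=
    ⟨hre.intervalIntegrable_deriv.1.ofReal, hre.intervalIntegrable_deriv.2.ofReal⟩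
  have i2 : IntervalIntegrable (fun t => ((deriv (fun s => (f s).im) t : ℝ) : ℂ)) volume a b :=
    ⟨him.intervalIntegrable_deriv.1.ofReal, him.intervalIntegrable_deriv.2.ofReal⟩
  rw [key, intervalIntegral.integral_add i1 (i2.mul_const _), intervalIntegral.integral_mul_const,
    intervalIntegral.integral_ofReal, intervalIntegral.integral_ofReal,
    hre.integral_deriv_eq_sub, him.integral_deriv_eq_sub]
  apply Complex.ext <;> simp

/-- Real closed `H¹` functions on `[0, T]`: absolutely continuous, with square integrable derivative
and equal values at both ends. -/
structure IsH1Loop (T : ℝ) (f : ℝ → ℝ) : Prop where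
  ac : AbsolutelyContinuousOnInterval f 0 T
  memLp_deriv : MemLp (deriv f) 2 (volume.restrict (Ioc 0 T))
  closed : f T = f 0

theorem memLp_of_continuousOn {E : Type*} [NormedAddCommGroup E] {f : ℝ → E}
    (hf : ContinuousOn f (Icc 0 T)) {p : ℝ≥0∞} :
    MemLp f p (volume.restrict (Ioc 0 T)) := by
  obtain ⟨C, hC⟩ := isCompact_Icc.exists_bound_of_continuousOn hf
  refine MemLp.of_bound ((hf.mono Ioc_subset_Icc_self).aestronglyMeasurable measurableSet_Ioc) C ?_
  rw [ae_restrict_iff' measurableSet_Ioc]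
  exact Filter.Eventually.of_forall fun t ht => hC t (Ioc_subset_Icc_self ht)

theorem IsH1Loop.memLp {f : ℝ → ℝ} (hT : 0 < T) (hf : IsH1Loop T f) :
    MemLp f 2 (volume.restrict (Ioc 0 T)) := by
  refine memLp_of_continuousOn ?_
  simpa [uIcc_of_le hT.le] using hf.ac.continuousOn

/-! ### Fourier series of closed `H¹` functions -/

/-- Integration by parts against the Fourier monomials; there is no boundary term as `f` is closed. -/
theorem fourierCoeffOn_deriv {f : ℝ → ℝ} (hT : 0 < T) (hf : IsH1Loop T f) (n : ℤ) :
    fourierCoeffOn hT (fun t => ((deriv f t : ℝ) : ℂ)) n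
      = (n * (2 * Real.pi / T) : ℝ) * Complex.I * fourierCoeffOn hT (fun t => (f t : ℂ)) n := by
  set w : ℝ := n * (2 * Real.pi / T) with hw
  have he : ∀ t : ℝ, (fourier (-n) (t : AddCircle (T - 0)) : ℂ)
      = Complex.exp (-(w * Complex.I * t)) := by
    intro t
    rw [fourier_coe_apply]
    congr 1
    simp [hw]
    ring
  have hde : ∀ t : ℝ, HasDerivAt (fun s : ℝ => Complex.exp (-(w * Complex.I * s)))
      (-(w * Complex.I) * Complex.exp (-(w * Complex.I * t))) t := by
    intro t
    have h := (((Complex.ofRealCLM.hasDerivAt (x := t)).const_mul (w * Complex.I)).neg).cexp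
    refine h.congr_deriv ?_
    simp
    ring
  have hec : ContDiff ℝ 1 (fun s : ℝ => Complex.exp (-(w * Complex.I * s))) := by
    have : ContDiff ℝ 1 (fun s : ℝ => (s : ℂ)) := Complex.ofRealCLM.contDiff
    fun_prop
  have hfc : ContinuousOn f (uIcc 0 T) := hf.ac.continuousOn
  have hfc' : ContinuousOn (fun t => (f t : ℂ)) (uIcc 0 T) :=
    Complex.continuous_ofReal.comp_continuousOn hfc
  have hprod : AbsolutelyContinuousOnInterval
      (fun t : ℝ => Complex.exp (-(w * Complex.I * t)) * (f t : ℂ)) 0 T :=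
    hec.contDiffOn.absolutelyContinuousOnInterval.fun_smul (absolutelyContinuous_ofReal hf.ac)
  have hftc := integral_deriv_eq_sub_complex hprod
  have hT0 : Complex.exp (-(w * Complex.I * T)) = 1 := by
    rw [Complex.exp_eq_one_iff]
    refine ⟨-n, ?_⟩
    have : (T : ℂ) ≠ 0 := by exact_mod_cast hT.ne'
    simp [hw]
    field_simp
  have hder : ∫ t in (0 : ℝ)..T,
        deriv (fun t : ℝ => Complex.exp (-(w * Complex.I * t)) * (f t : ℂ)) t
      = ∫ t in (0 : ℝ)..T, (-(w * Complex.I) * (Complex.exp (-(w * Complex.I * t)) * (f t : ℂ))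
        + Complex.exp (-(w * Complex.I * t)) * ((deriv f t : ℝ) : ℂ)) := by
    refine intervalIntegral.integral_congr_ae_restrict ?_
    filter_upwards [ae_differentiableAt_real hf.ac] with t ht
    refine ((hde t).mul ht.hasDerivAt.ofReal_comp).deriv.trans ?_
    ring
  have i1 : IntervalIntegrable
      (fun t : ℝ => Complex.exp (-(w * Complex.I * t)) * (f t : ℂ)) volume 0 T :=
    (hec.continuous.continuousOn.mul hfc').intervalIntegrable
  have i2 : IntervalIntegrable
      (fun t : ℝ => Complex.exp (-(w * Complex.I * t)) * ((deriv f t : ℝ) : ℂ)) volume 0 T :=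
    IntervalIntegrable.continuousOn_mul
      ⟨hf.ac.intervalIntegrable_deriv.1.ofReal, hf.ac.intervalIntegrable_deriv.2.ofReal⟩
      hec.continuous.continuousOn
  rw [hder, intervalIntegral.integral_add (i1.const_mul _) i2,
    intervalIntegral.integral_const_mul, hT0, hf.closed] at hftc
  rw [fourierCoeffOn_eq_integral, fourierCoeffOn_eq_integral]
  simp only [he, smul_eq_mul, Complex.real_smul]
  simp only [Complex.ofReal_zero, mul_zero, neg_zero, Complex.exp_zero, sub_self] at hftc
  linear_combination ((1 / (T - 0) : ℝ) : ℂ) * hftc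

/-- Parseval's identity for `∫ (f'² - s² f²)`: the `n`-th Fourier mode contributes with the sign of
`(2 π n / T)² - s²`. -/
theorem hasSum_wirtinger {f : ℝ → ℝ} (hT : 0 < T) (hf : IsH1Loop T f) (s : ℝ) :
    HasSum (fun n : ℤ => ((n * (2 * Real.pi / T)) ^ 2 - s ^ 2)
        * ‖fourierCoeffOn hT (fun t => (f t : ℂ)) n‖ ^ 2)
      (T⁻¹ * ∫ t in (0 : ℝ)..T, (deriv f t ^ 2 - s ^ 2 * f t ^ 2)) := by
  have h1 := hasSum_sq_fourierCoeffOn hT (f := fun t => (f t : ℂ)) (hf.memLp hT).ofReal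
  have h2 := hasSum_sq_fourierCoeffOn hT (f := fun t => ((deriv f t : ℝ) : ℂ)) hf.memLp_deriv.ofReal
  have h := h2.sub (h1.mul_left (s ^ 2))
  have i1 : IntervalIntegrable (fun t => deriv f t ^ 2) volume 0 T :=
    (intervalIntegrable_iff_integrableOn_Ioc_of_le hT.le).2 hf.memLp_deriv.integrable_sq
  have i2 : IntervalIntegrable (fun t => f t ^ 2) volume 0 T :=
    (intervalIntegrable_iff_integrableOn_Ioc_of_le hT.le).2 (hf.memLp hT).integrable_sq
  rw [intervalIntegral.integral_sub i1 (i2.const_mul _), intervalIntegral.integral_const_mul]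
  convert! h using 1
  · funext n
    rw [fourierCoeffOn_deriv hT hf, norm_mul, norm_mul, Complex.norm_I, Complex.norm_real, mul_one,
      Real.norm_eq_abs, mul_pow |_|, sq_abs]
    ring
  · simp
    ring

theorem fourierCoeffOn_neg {f : ℝ → ℝ} (hT : 0 < T) (n : ℤ) :
    fourierCoeffOn hT (fun t => (f t : ℂ)) (-n)
      = (starRingEnd ℂ) (fourierCoeffOn hT (fun t => (f t : ℂ)) n) := by
  rw [fourierCoeffOn_eq_integral, fourierCoeffOn_eq_integral, neg_neg, Complex.real_smul,
    Complex.real_smul, map_mul, Complex.conj_ofReal, intervalIntegral.integral_of_le hT.le,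
    intervalIntegral.integral_of_le hT.le, ← integral_conj]
  congr 1
  refine integral_congr_ae (Filter.Eventually.of_forall fun t => ?_)
  simp only [smul_eq_mul, map_mul, Complex.conj_ofReal, ← fourier_neg, neg_neg]

theorem fourierCoeffOn_zero {f : ℝ → ℝ} (hT : 0 < T) :
    fourierCoeffOn hT (fun t => (f t : ℂ)) 0 = ((T⁻¹ * ∫ t in (0 : ℝ)..T, f t : ℝ) : ℂ) := by
  rw [fourierCoeffOn_eq_integral]
  simp [← intervalIntegral.integral_ofReal]

/-- A Wirtinger inequality: if the modes `1, …, i` of `f` vanish and `s ≤ 2 π (i + 1) / T`, then only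
the mean of `f` can make `∫ (f'² - s² f²)` negative. -/
theorem integral_wirtinger_ge {f : ℝ → ℝ} (hT : 0 < T) (hf : IsH1Loop T f) {s : ℝ} (hs : 0 ≤ s)
    {i : ℕ} (hsi : s ≤ (i + 1) * (2 * Real.pi / T))
    (hc : ∀ n : Fin i, fourierCoeffOn hT (fun t => (f t : ℂ)) ((n : ℤ) + 1) = 0) :
    -(s ^ 2 * T⁻¹ * (∫ t in (0 : ℝ)..T, f t) ^ 2)
      ≤ ∫ t in (0 : ℝ)..T, (deriv f t ^ 2 - s ^ 2 * f t ^ 2) := by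
  have hpos : ∀ n : ℕ, 0 ≤ (((n : ℝ) + 1) * (2 * Real.pi / T)) ^ 2 - s ^ 2 ∨
      fourierCoeffOn hT (fun t => (f t : ℂ)) ((n : ℤ) + 1) = 0 := by
    intro n
    by_cases hn : n < i
    · exact Or.inr (hc ⟨n, hn⟩)
    · left
      have hn' : (i : ℝ) ≤ n := by exact_mod_cast not_lt.1 hn
      have : s ≤ ((n : ℝ) + 1) * (2 * Real.pi / T) := hsi.trans (by gcongr)
      have := pow_le_pow_left₀ hs this 2
      linarith
  -- All terms of Parseval's sum but that of index `0` are nonnegative.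
  have h := le_hasSum (hasSum_wirtinger hT hf s) 0 fun n hn => by
    obtain ⟨k, rfl | rfl⟩ : ∃ k : ℕ, n = (k : ℤ) + 1 ∨ n = -((k : ℤ) + 1) := by
      refine ⟨n.natAbs - 1, ?_⟩
      omega
    · rcases hpos k with h | h
      · push_cast
        positivity
      · simp [h]
    · rw [fourierCoeffOn_neg]
      rcases hpos k with h | h
      · push_cast
        rw [neg_mul, neg_sq]
        positivity
      · simp [h]
  rw [fourierCoeffOn_zero, Complex.norm_real, Real.norm_eq_abs, sq_abs] at h
  have h' := mul_le_mul_of_nonneg_left h hT.le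
  rw [mul_inv_cancel_left₀ hT.ne'] at h'
  refine le_trans (le_of_eq ?_) h'
  simp
  field_simp

/-- The Cauchy–Schwarz inequality for `f` and the constant function. -/
theorem sq_integral_le {f : ℝ → ℝ} (hT : 0 < T) (hf : MemLp f 2 (volume.restrict (Ioc 0 T))) :
    T⁻¹ * (∫ t in (0 : ℝ)..T, f t) ^ 2 ≤ ∫ t in (0 : ℝ)..T, f t ^ 2 := by
  set M := T⁻¹ * ∫ t in (0 : ℝ)..T, f t with hM
  have i1 : IntervalIntegrable f volume 0 T :=
    (intervalIntegrable_iff_integrableOn_Ioc_of_le hT.le).2 (hf.integrable (by norm_num))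
  have i2 : IntervalIntegrable (fun t => f t ^ 2) volume 0 T :=
    (intervalIntegrable_iff_integrableOn_Ioc_of_le hT.le).2 hf.integrable_sq
  have h : 0 ≤ ∫ t in (0 : ℝ)..T, (f t - M) ^ 2 :=
    intervalIntegral.integral_nonneg hT.le fun t _ => sq_nonneg _
  have e : ∀ t, (f t - M) ^ 2 = f t ^ 2 - 2 * M * f t + M ^ 2 := fun t => by ring
  simp only [e] at h
  rw [intervalIntegral.integral_add (i2.sub (i1.const_mul _)) (by simp),
    intervalIntegral.integral_sub i2 (i1.const_mul _), intervalIntegral.integral_const_mul,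
    intervalIntegral.integral_const] at h
  have hI : ∫ t in (0 : ℝ)..T, f t = T * M := by
    rw [hM]
    field_simp
  rw [hI] at h ⊢
  have : T⁻¹ * (T * M) ^ 2 = T * M ^ 2 := by field_simp
  rw [this]
  simp at h
  nlinarith

/-- The second variation in the rotating frame is nonnegative as soon as the modes `1, …, i` of the
radial component `f` vanish. The mean of `f` is controlled by the square `(g' + K f)²`, since `g'`
has mean zero. -/
theorem integral_rotating_nonneg {f g : ℝ → ℝ} (hT : 0 < T) (hf : IsH1Loop T f)
    (hg : IsH1Loop T g) {s K G : ℝ} (hs : 0 ≤ s) (hsK : s ^ 2 ≤ G ^ 2 * K ^ 2)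
    {i : ℕ} (hsi : s ≤ (i + 1) * (2 * Real.pi / T))
    (hc : ∀ n : Fin i, fourierCoeffOn hT (fun t => (f t : ℂ)) ((n : ℤ) + 1) = 0) :
    0 ≤ ∫ t in (0 : ℝ)..T,
      (G ^ 2 * (deriv g t + K * f t) ^ 2 + (deriv f t ^ 2 - s ^ 2 * f t ^ 2)) := by
  have m1 : MemLp (fun t => deriv g t + K * f t) 2 (volume.restrict (Ioc 0 T)) :=
    hg.memLp_deriv.add ((hf.memLp hT).const_mul K)
  have i1 : IntervalIntegrable (fun t => (deriv g t + K * f t) ^ 2) volume 0 T :=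
    (intervalIntegrable_iff_integrableOn_Ioc_of_le hT.le).2 m1.integrable_sq
  have i2 : IntervalIntegrable (fun t => deriv f t ^ 2) volume 0 T :=
    (intervalIntegrable_iff_integrableOn_Ioc_of_le hT.le).2 hf.memLp_deriv.integrable_sq
  have i3 : IntervalIntegrable (fun t => f t ^ 2) volume 0 T :=
    (intervalIntegrable_iff_integrableOn_Ioc_of_le hT.le).2 (hf.memLp hT).integrable_sq
  have i4 : IntervalIntegrable f volume 0 T := hf.ac.continuousOn.intervalIntegrable
  rw [intervalIntegral.integral_add (i1.const_mul _) (i2.sub (i3.const_mul _)),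
    intervalIntegral.integral_const_mul]
  have h1 := integral_wirtinger_ge hT hf hs hsi hc
  have h2 := sq_integral_le hT m1
  rw [intervalIntegral.integral_add hg.ac.intervalIntegrable_deriv (i4.const_mul _),
    hg.ac.integral_deriv_eq_sub, hg.closed, sub_self, zero_add,
    intervalIntegral.integral_const_mul] at h2
  have h3 := mul_le_mul_of_nonneg_left h2 (sq_nonneg G)
  have h4 : 0 ≤ (G ^ 2 * K ^ 2 - s ^ 2) * (T⁻¹ * (∫ t in (0 : ℝ)..T, f t) ^ 2) :=
    mul_nonneg (by linarith) (by positivity)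
  nlinarith

/-- If the Fourier modes of `f` are concentrated on `1 ≤ |n| ≤ i` and `2 π i / T < s`, then
`∫ (f'² - s² f²)` is negative, unless all the modes vanish. -/
theorem integral_wirtinger_neg {f : ℝ → ℝ} (hT : 0 < T) (hf : IsH1Loop T f) {s : ℝ}
    {i : ℕ} (hsi : i * (2 * Real.pi / T) < s)
    (hc : ∀ n : ℤ, i < n.natAbs → fourierCoeffOn hT (fun t => (f t : ℂ)) n = 0)
    {j : ℤ} (hj : fourierCoeffOn hT (fun t => (f t : ℂ)) j ≠ 0) :
    ∫ t in (0 : ℝ)..T, (deriv f t ^ 2 - s ^ 2 * f t ^ 2) < 0 := by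
  have hlt : ∀ n : ℤ, n.natAbs ≤ i → (n * (2 * Real.pi / T)) ^ 2 - s ^ 2 < 0 := by
    intro n hn
    have h1 : |(n : ℝ)| ≤ i := by
      rw [← Int.cast_abs, Int.abs_eq_natAbs]
      exact_mod_cast hn
    have h2 : |(n : ℝ) * (2 * Real.pi / T)| < s := by
      rw [abs_mul, abs_of_pos (a := 2 * Real.pi / T) (by positivity)]
      exact lt_of_le_of_lt (by gcongr) hsi
    have := sq_lt_sq' (by linarith [abs_lt.1 h2]) (abs_lt.1 h2).2
    linarith
  have hle : ∀ n : ℤ, ((n * (2 * Real.pi / T)) ^ 2 - s ^ 2)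
      * ‖fourierCoeffOn hT (fun t => (f t : ℂ)) n‖ ^ 2 ≤ 0 := by
    intro n
    by_cases hn : i < n.natAbs
    · simp [hc n hn]
    · exact mul_nonpos_of_nonpos_of_nonneg (hlt n (not_lt.1 hn)).le (by positivity)
  have hji : j.natAbs ≤ i := by
    by_contra h
    exact hj (hc j (not_le.1 h))
  have h := hasSum_lt hle (i := j)
    (mul_neg_of_neg_of_pos (hlt j hji) (by positivity)) (hasSum_wirtinger hT hf s) hasSum_zero
  exact neg_of_mul_neg_right h (by positivity)

end RelKepler

namespace RelKepler

/-! ### The rotating frame -/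

/-- The unit vector rotating at angular velocity `w`, starting at `u`. -/
noncomputable def frame (u : ℂ) (w t : ℝ) : ℂ := u * Complex.exp ((w * t : ℝ) * Complex.I)

variable {u : ℂ} {w T : ℝ}

theorem norm_frame (hu : ‖u‖ = 1) (t : ℝ) : ‖frame u w t‖ = 1 := by
  rw [frame, norm_mul, Complex.norm_exp_ofReal_mul_I, hu, one_mul]

theorem hasDerivAt_frame (t : ℝ) :
    HasDerivAt (frame u w) (w * Complex.I * frame u w t) t := by
  have h := (((Complex.ofRealCLM.hasDerivAt (x := w * t)).scomp t
    ((hasDerivAt_id t).const_mul w)).mul_const Complex.I).cexp.const_mul u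
  refine h.congr_deriv ?_
  simp [frame]
  ring

theorem contDiff_frame : ContDiff ℝ 1 (frame u w) := by
  have : ContDiff ℝ 1 (fun t : ℝ => ((w * t : ℝ) : ℂ)) :=
    Complex.ofRealCLM.contDiff.comp (contDiff_const.mul contDiff_id)
  unfold frame
  fun_prop

theorem contDiff_conj_frame : ContDiff ℝ 1 (fun t => (starRingEnd ℂ) (frame u w t)) :=
  Complex.conjCLE.contDiff.comp contDiff_frame

theorem periodic_frame {k : ℕ} (hwT : w * T = 2 * Real.pi * k) :
    Function.Periodic (frame u w) T := by
  intro t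
  rw [frame, frame, mul_add, hwT]
  have := Complex.exp_periodic.nat_mul k ((w * t : ℝ) * Complex.I)
  rw [← this]
  congr 2
  push_cast
  ring

theorem conj_mul_self_of_norm_one {e : ℂ} (he : ‖e‖ = 1) : (starRingEnd ℂ) e * e = 1 := by
  rw [mul_comm, Complex.mul_conj, Complex.normSq_eq_norm_sq, he]
  simp

theorem inner_mul_left_of_norm_one {e : ℂ} (he : ‖e‖ = 1) (z v : ℂ) :
    inner ℝ (e * z) (e * v) = inner ℝ z v := by
  rw [Complex.inner, Complex.inner, map_mul]
  have := conj_mul_self_of_norm_one he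
  congr 1
  linear_combination (v * (starRingEnd ℂ) z) * this

theorem lorentz_congr {c : ℝ} {v v' : ℂ} (h : ‖v‖ = ‖v'‖) : lorentz c v = lorentz c v' := by
  rw [lorentz, lorentz, h]

/-- The integrand of the second variation in the coordinates of the rotating frame. Up to the null
Lagrangian `(p_re p_im)'`, it is a square plus the form `p_re'² - s² p_re²` in the radial component
alone. -/
theorem integrand_rotating {m c α R G K s : ℝ} {e p p' : ℂ} (he : ‖e‖ = 1) (hR : 0 < R)
    (hG0 : 0 < G) (hG : lorentz c (R * w : ℝ) = G)
    (hrel : G ^ 2 * (1 - (R * w) ^ 2 / c ^ 2) = 1) (hbal : m * G * w ^ 2 * R ^ 3 = α)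
    (hK : G ^ 2 * K = w * (G ^ 2 + 1)) (hs : G * s = w) :
    1 / 2 * inner ℝ (hessVel m c (R * (w * Complex.I * e)) (w * Complex.I * e * p + e * p'))
        (w * Complex.I * e * p + e * p')
      + 1 / 2 * inner ℝ (hessPos α (R * e) (e * p)) (e * p)
    = m * G / 2 * ((G ^ 2 * (p'.im + K * p.re) ^ 2 + (p'.re ^ 2 - s ^ 2 * p.re ^ 2))
        - 2 * w * (p'.re * p.im + p.re * p'.im)) := by
  have e1 : (R : ℂ) * (w * Complex.I * e) = e * ((R * w : ℝ) * Complex.I) := by push_cast; ring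
  have e2 : w * Complex.I * e * p + e * p' = e * (w * Complex.I * p + p') := by ring
  have hl : lorentz c (e * ((R * w : ℝ) * Complex.I)) = G := by
    rw [← hG]
    refine lorentz_congr ?_
    simp [he]
  have hn : ‖(R : ℂ) * e‖ = R := by simp [he, abs_of_pos hR]
  rw [e1, e2, hessVel, hessPos, hl, hn, inner_add_left, inner_sub_left, real_inner_smul_left,
    real_inner_smul_left, real_inner_smul_left, real_inner_smul_left, mul_comm (R : ℂ) e]
  simp only [inner_mul_left_of_norm_one he]
  have h1 : G ^ 2 * K ^ 2 - s ^ 2 = w ^ 2 * (G ^ 2 + 2) := by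
    have : G ^ 2 ≠ 0 := by positivity
    refine mul_left_cancel₀ this ?_
    linear_combination (G ^ 2 * K + w * (G ^ 2 + 1)) * hK - (G * s + w) * hs
  have h2 : G ^ 2 * (R * w) ^ 2 / c ^ 2 = G ^ 2 - 1 := by
    linear_combination -hrel
  have h3 : α / R ^ 3 = m * G * w ^ 2 := by
    rw [← hbal]
    field_simp
  have h4 : 3 * α / R ^ 5 * R ^ 2 = 3 * (m * G * w ^ 2) := by
    rw [← h3]
    field_simp
  have h5 : m / c ^ 2 * G ^ 3 * (R * w) ^ 2 = m * G * (G ^ 2 - 1) := by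
    rw [← h2]
    ring
  simp only [Complex.inner, Complex.add_re, Complex.add_im, Complex.mul_re, Complex.mul_im,
    Complex.ofReal_re, Complex.ofReal_im, Complex.I_re, Complex.I_im, Complex.conj_re,
    Complex.conj_im, map_add, map_mul]
  rw [h3]
  linear_combination (1 / 2 * (p'.im + w * p.re) ^ 2) * h5 + (1 / 2 * p.re ^ 2) * h4
    - m * G * p'.im * p.re * hK - m * G / 2 * p.re ^ 2 * h1

/-- The radial component of `q` in the rotating frame. -/
noncomputable def radial (u : ℂ) (w : ℝ) (q : ℝ → ℂ) (t : ℝ) : ℝ :=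
  ((starRingEnd ℂ) (frame u w t) * q t).re

/-- The tangential component of `q` in the rotating frame. -/
noncomputable def tangential (u : ℂ) (w : ℝ) (q : ℝ → ℂ) (t : ℝ) : ℝ :=
  ((starRingEnd ℂ) (frame u w t) * q t).im

theorem absolutelyContinuous_conj_frame_mul {q : ℝ → ℂ}
    (hq : AbsolutelyContinuousOnInterval q 0 T) :
    AbsolutelyContinuousOnInterval (fun t => (starRingEnd ℂ) (frame u w t) * q t) 0 T :=
  contDiff_conj_frame.contDiffOn.absolutelyContinuousOnInterval.fun_smul hq

theorem memLp_deriv_conj_frame_mul (hT : 0 < T) (hu : ‖u‖ = 1) {q : ℝ → ℂ} (hq : q ∈ H1T T) :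
    MemLp (deriv (fun t => (starRingEnd ℂ) (frame u w t) * q t)) 2
      (volume.restrict (Ioc 0 T)) := by
  obtain ⟨-, hac, hL⟩ := hq
  rw [uIoc_of_le hT.le] at hL
  have hqc : ContinuousOn q (Icc 0 T) := by simpa [uIcc_of_le hT.le] using hac.continuousOn
  have h1 : MemLp (fun t => deriv (fun t => (starRingEnd ℂ) (frame u w t)) t * q t) 2
      (volume.restrict (Ioc 0 T)) :=
    memLp_of_continuousOn ((contDiff_conj_frame.continuous_deriv le_rfl).continuousOn.mul hqc)
  have h2 : MemLp (fun t => (starRingEnd ℂ) (frame u w t) * deriv q t) 2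
      (volume.restrict (Ioc 0 T)) := by
    refine hL.of_le (contDiff_conj_frame.continuous.aestronglyMeasurable.mul
      hL.aestronglyMeasurable) (Filter.Eventually.of_forall fun t => ?_)
    rw [norm_mul, RCLike.norm_conj, norm_frame hu, one_mul]
  refine (h1.add h2).ae_eq ?_
  have hd := ae_differentiableAt_complex hac
  rw [uIoc_of_le hT.le] at hd
  filter_upwards [hd] with t ht
  exact (((contDiff_conj_frame.differentiable one_ne_zero t).hasDerivAt.mul
    ht.hasDerivAt).deriv).symm

theorem conj_frame_mul_closed {k : ℕ} (hwT : w * T = 2 * Real.pi * k) {q : ℝ → ℂ}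
    (hq : q ∈ H1T T) :
    (starRingEnd ℂ) (frame u w T) * q T = (starRingEnd ℂ) (frame u w 0) * q 0 := by
  rw [(periodic_frame hwT).eq, hq.1.eq]

theorem isH1Loop_radial {k : ℕ} (hT : 0 < T) (hu : ‖u‖ = 1) (hwT : w * T = 2 * Real.pi * k)
    {q : ℝ → ℂ} (hq : q ∈ H1T T) : IsH1Loop T (radial u w q) where
  ac := absolutelyContinuous_re (absolutelyContinuous_conj_frame_mul hq.2.1)
  memLp_deriv := by
    refine (memLp_deriv_conj_frame_mul (w := w) hT hu hq).re.ae_eq ?_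
    have hd := ae_differentiableAt_complex (absolutelyContinuous_conj_frame_mul (u := u) (w := w)
      hq.2.1)
    rw [uIoc_of_le hT.le] at hd
    filter_upwards [hd] with t ht
    exact (hasDerivAt_re ht.hasDerivAt).deriv.symm
  closed := by rw [radial, radial, conj_frame_mul_closed hwT hq]

theorem isH1Loop_tangential {k : ℕ} (hT : 0 < T) (hu : ‖u‖ = 1) (hwT : w * T = 2 * Real.pi * k)
    {q : ℝ → ℂ} (hq : q ∈ H1T T) : IsH1Loop T (tangential u w q) where
  ac := absolutelyContinuous_im (absolutelyContinuous_conj_frame_mul hq.2.1)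
  memLp_deriv := by
    refine (memLp_deriv_conj_frame_mul (w := w) hT hu hq).im.ae_eq ?_
    have hd := ae_differentiableAt_complex (absolutelyContinuous_conj_frame_mul (u := u) (w := w)
      hq.2.1)
    rw [uIoc_of_le hT.le] at hd
    filter_upwards [hd] with t ht
    exact (hasDerivAt_im ht.hasDerivAt).deriv.symm
  closed := by rw [tangential, tangential, conj_frame_mul_closed hwT hq]

/-- The second variation along the circular orbit `R • frame u w`, as a sum of a square and a
quadratic form in the radial component with constant coefficients. -/
theorem secondVariation_circular {m c α R G K s : ℝ} {k : ℕ} (hT : 0 < T) (hu : ‖u‖ = 1)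
    (hR : 0 < R) (hG0 : 0 < G) (hG : lorentz c (R * w : ℝ) = G)
    (hrel : G ^ 2 * (1 - (R * w) ^ 2 / c ^ 2) = 1) (hbal : m * G * w ^ 2 * R ^ 3 = α)
    (hK : G ^ 2 * K = w * (G ^ 2 + 1)) (hs : G * s = w) (hwT : w * T = 2 * Real.pi * k)
    (q : H1T T) :
    secondVariation m c α T (fun t => R * frame u w t) q = m * G / 2 * ∫ t in (0 : ℝ)..T,
      (G ^ 2 * (deriv (tangential u w q.1) t + K * radial u w q.1 t) ^ 2
        + (deriv (radial u w q.1) t ^ 2 - s ^ 2 * radial u w q.1 t ^ 2)) := by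
  set f := radial u w q.1 with hf
  set g := tangential u w q.1 with hg
  have Hf : IsH1Loop T f := isH1Loop_radial hT hu hwT q.2
  have Hg : IsH1Loop T g := isH1Loop_tangential hT hu hwT q.2
  have m1 : MemLp (fun t => deriv g t + K * f t) 2 (volume.restrict (Ioc 0 T)) :=
    Hg.memLp_deriv.add ((Hf.memLp hT).const_mul K)
  have i1 : IntervalIntegrable (fun t => (deriv g t + K * f t) ^ 2) volume 0 T :=
    (intervalIntegrable_iff_integrableOn_Ioc_of_le hT.le).2 m1.integrable_sq
  have i2 : IntervalIntegrable (fun t => deriv f t ^ 2) volume 0 T :=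
    (intervalIntegrable_iff_integrableOn_Ioc_of_le hT.le).2 Hf.memLp_deriv.integrable_sq
  have i3 : IntervalIntegrable (fun t => f t ^ 2) volume 0 T :=
    (intervalIntegrable_iff_integrableOn_Ioc_of_le hT.le).2 (Hf.memLp hT).integrable_sq
  have i4 : IntervalIntegrable (fun t => deriv f t * g t + f t * deriv g t) volume 0 T :=
    (Hf.ac.intervalIntegrable_deriv.mul_continuousOn Hg.ac.continuousOn).add
      (Hg.ac.intervalIntegrable_deriv.continuousOn_mul Hf.ac.continuousOn)
  have hnull := Hf.ac.integral_deriv_mul_eq_sub Hg.ac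
  rw [Hf.closed, Hg.closed, sub_self] at hnull
  have hint : secondVariation m c α T (fun t => R * frame u w t) q
      = ∫ t in (0 : ℝ)..T, m * G / 2 * ((G ^ 2 * (deriv g t + K * f t) ^ 2
        + (deriv f t ^ 2 - s ^ 2 * f t ^ 2)) - 2 * w * (deriv f t * g t + f t * deriv g t)) := by
    refine intervalIntegral.integral_congr_ae_restrict ?_
    filter_upwards [ae_differentiableAt_complex q.2.2.1] with t hq
    have hp : DifferentiableAt ℝ (fun t => (starRingEnd ℂ) (frame u w t) * q.1 t) t :=
      (contDiff_conj_frame.differentiable one_ne_zero t).mul hq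
    have hqp : q.1 = fun t => frame u w t * ((starRingEnd ℂ) (frame u w t) * q.1 t) := by
      funext t
      rw [← mul_assoc, mul_comm (frame u w t), conj_mul_self_of_norm_one (norm_frame hu t), one_mul]
    have hdq : deriv q.1 t = w * Complex.I * frame u w t * ((starRingEnd ℂ) (frame u w t) * q.1 t)
        + frame u w t * deriv (fun t => (starRingEnd ℂ) (frame u w t) * q.1 t) t := by
      conv_lhs => rw [hqp]
      exact ((hasDerivAt_frame t).mul hp.hasDerivAt).deriv
    have hdx : deriv (fun t => (R : ℂ) * frame u w t) t = R * (w * Complex.I * frame u w t) :=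
      ((hasDerivAt_frame t).const_mul _).deriv
    have hdf : deriv f t = (deriv (fun t => (starRingEnd ℂ) (frame u w t) * q.1 t) t).re :=
      (hasDerivAt_re hp.hasDerivAt).deriv
    have hdg : deriv g t = (deriv (fun t => (starRingEnd ℂ) (frame u w t) * q.1 t) t).im :=
      (hasDerivAt_im hp.hasDerivAt).deriv
    have hqt := congrFun hqp t
    simp only [hdx, hdq, hdf, hdg]
    have := integrand_rotating (p := (starRingEnd ℂ) (frame u w t) * q.1 t)
      (p' := deriv (fun t => (starRingEnd ℂ) (frame u w t) * q.1 t) t)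
      (norm_frame (w := w) hu t) hR hG0
      hG hrel hbal hK hs
    rw [← hqt] at this
    exact this
  rw [hint, intervalIntegral.integral_const_mul, intervalIntegral.integral_sub
    ((i1.const_mul _).add (i2.sub (i3.const_mul _))) (i4.const_mul _),
    intervalIntegral.integral_const_mul, hnull, mul_zero, sub_zero]

end RelKepler

namespace RelKepler

variable {T : ℝ}

/-! ### Trigonometric polynomials -/

/-- The trigonometric polynomial `∑ zₙ exp (2 π i (n + 1) t / T)` over `n < N`. -/
noncomputable def trigPoly (T : ℝ) {N : ℕ} (z : Fin N → ℂ) (t : ℝ) : ℂ :=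
  ∑ n, z n * Complex.exp ((((n : ℕ) + 1) * (2 * Real.pi / T) * t : ℝ) * Complex.I)

/-- The coefficients of the primitive of mean zero of a trigonometric polynomial. -/
noncomputable def primCoeff (T : ℝ) {N : ℕ} (z : Fin N → ℂ) (n : Fin N) : ℂ :=
  z n / ((((n : ℕ) + 1) * (2 * Real.pi / T) : ℝ) * Complex.I)

variable {N : ℕ}

theorem contDiff_trigPoly (z : Fin N → ℂ) : ContDiff ℝ 1 (trigPoly T z) := by
  have : ∀ a : ℝ, ContDiff ℝ 1 (fun t : ℝ => ((a * t : ℝ) : ℂ)) := fun a =>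
    Complex.ofRealCLM.contDiff.comp (contDiff_const.mul contDiff_id)
  unfold trigPoly
  fun_prop

theorem periodic_trigPoly (hT : 0 < T) (z : Fin N → ℂ) : Function.Periodic (trigPoly T z) T := by
  intro t
  refine Finset.sum_congr rfl fun n _ => ?_
  have h := Complex.exp_periodic.nat_mul ((n : ℕ) + 1)
    ((((n : ℕ) + 1) * (2 * Real.pi / T) * t : ℝ) * Complex.I)
  rw [← h]
  have : (T : ℂ) ≠ 0 := by exact_mod_cast hT.ne'
  congr 2
  push_cast
  field_simp

theorem trigPoly_add (z z' : Fin N → ℂ) (t : ℝ) :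
    trigPoly T (z + z') t = trigPoly T z t + trigPoly T z' t := by
  simp [trigPoly, add_mul, Finset.sum_add_distrib]

theorem trigPoly_smul (a : ℝ) (z : Fin N → ℂ) (t : ℝ) :
    trigPoly T (a • z) t = a * trigPoly T z t := by
  simp [trigPoly, mul_assoc, Finset.mul_sum]

theorem primCoeff_add (z z' : Fin N → ℂ) :
    primCoeff T (z + z') = primCoeff T z + primCoeff T z' := by
  funext n
  simp [primCoeff, add_div]

theorem primCoeff_smul (a : ℝ) (z : Fin N → ℂ) : primCoeff T (a • z) = a • primCoeff T z := by
  funext n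
  simp [primCoeff, mul_div_assoc]

theorem hasDerivAt_trigPoly_primCoeff (hT : 0 < T) (z : Fin N → ℂ) (t : ℝ) :
    HasDerivAt (trigPoly T (primCoeff T z)) (trigPoly T z t) t := by
  unfold trigPoly
  refine HasDerivAt.fun_sum fun n _ => ?_
  have ha : ((n : ℕ) + 1) * (2 * Real.pi / T) ≠ 0 := by positivity
  simp only [primCoeff]
  generalize ((n : ℕ) + 1) * (2 * Real.pi / T) = a at ha
  have hn : (a : ℂ) ≠ 0 := Complex.ofReal_ne_zero.2 ha
  have h := (((Complex.ofRealCLM.hasDerivAt (x := a * t)).scomp t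
    ((hasDerivAt_id t).const_mul a)).mul_const Complex.I).cexp.const_mul (z n / (a * Complex.I))
  refine h.congr_deriv ?_
  simp only [Function.comp, Complex.ofRealCLM_apply, mul_one, Complex.real_smul,
    Complex.ofReal_one]
  field_simp

theorem fourierCoeffOn_fourier (hT : 0 < T) (m j : ℤ) :
    fourierCoeffOn hT (fun t => (fourier m (t : AddCircle (T - 0)) : ℂ)) j
      = if m = j then 1 else 0 := by
  rw [fourierCoeffOn_eq_integral]
  simp only [smul_eq_mul, ← fourier_add]
  have hT' : (T : ℂ) ≠ 0 := by exact_mod_cast hT.ne'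
  split_ifs with h
  · simp [h, hT']
  · have hz : (2 * Real.pi * Complex.I * ((-j + m : ℤ) : ℂ) / T) ≠ 0 := by
      have : ((-j + m : ℤ) : ℂ) ≠ 0 := by
        rw [Int.cast_ne_zero]
        omega
      exact div_ne_zero (mul_ne_zero Complex.two_pi_I_ne_zero this) hT'
    have e : ∀ t : ℝ, (fourier (-j + m) (t : AddCircle (T - 0)) : ℂ)
        = Complex.exp ((2 * Real.pi * Complex.I * ((-j + m : ℤ) : ℂ) / T) * t) := by
      intro t
      rw [fourier_coe_apply, sub_zero]
      congr 1
      ring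
    simp only [e]
    rw [integral_exp_mul_complex hz, div_mul_cancel₀ _ hT',
      show 2 * Real.pi * Complex.I * ((-j + m : ℤ) : ℂ)
        = ((-j + m : ℤ) : ℂ) * (2 * Real.pi * Complex.I) by ring,
      Complex.exp_int_mul_two_pi_mul_I]
    simp

theorem fourierCoeffOn_re_trigPoly (hT : 0 < T) (z : Fin N → ℂ) (j : ℤ) :
    fourierCoeffOn hT (fun t => ((trigPoly T z t).re : ℂ)) j
      = ∑ n : Fin N, ((z n / 2) * (if ((n : ℤ) + 1) = j then 1 else 0)
        + ((starRingEnd ℂ) (z n) / 2) * (if -((n : ℤ) + 1) = j then 1 else 0)) := by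
  have e : ∀ t : ℝ, ((trigPoly T z t).re : ℂ)
      = ∑ n : Fin N, ((z n / 2) * fourier ((n : ℤ) + 1) (t : AddCircle (T - 0))
        + ((starRingEnd ℂ) (z n) / 2) * fourier (-((n : ℤ) + 1)) (t : AddCircle (T - 0))) := by
    intro t
    rw [Complex.re_eq_add_conj, trigPoly, map_sum, ← Finset.sum_add_distrib, Finset.sum_div]
    refine Finset.sum_congr rfl fun n _ => ?_
    have : (fourier ((n : ℤ) + 1) (t : AddCircle (T - 0)) : ℂ)
        = Complex.exp ((((n : ℕ) + 1) * (2 * Real.pi / T) * t : ℝ) * Complex.I) := by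
      rw [fourier_coe_apply, sub_zero]
      congr 1
      push_cast
      ring
    rw [fourier_neg, this, map_mul]
    ring
  have hint : ∀ (a : ℂ) (m : ℤ), IntervalIntegrable (fun t : ℝ =>
      a * ((fourier (-j) (t : AddCircle (T - 0)) : ℂ) * fourier m (t : AddCircle (T - 0))))
      volume 0 T := by
    intro a m
    refine Continuous.intervalIntegrable ?_ _ _
    have : ∀ l : ℤ, Continuous (fun t : ℝ => (fourier l (t : AddCircle (T - 0)) : ℂ)) := fun l =>
      (fourier l).continuous.comp (AddCircle.continuous_mk' _)
    exact continuous_const.mul ((this _).mul (this _))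
  simp only [← fourierCoeffOn_fourier hT, fourierCoeffOn_eq_integral]
  simp only [e, smul_eq_mul, Finset.mul_sum, mul_add, Complex.real_smul]
  have e2 : ∀ (b c d : ℂ), b * (c * d) = c * (b * d) := fun b c d => by ring
  simp only [e2 (fourier (-j) _)]
  rw [intervalIntegral.integral_finsetSum fun n _ => (hint _ _).add (hint _ _), Finset.mul_sum]
  refine Finset.sum_congr rfl fun n _ => ?_
  rw [intervalIntegral.integral_add (hint _ _) (hint _ _), intervalIntegral.integral_const_mul,
    intervalIntegral.integral_const_mul]
  ring

theorem fourierCoeffOn_re_trigPoly_eq_zero (hT : 0 < T) (z : Fin N → ℂ) {j : ℤ}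
    (hj : N < j.natAbs) : fourierCoeffOn hT (fun t => ((trigPoly T z t).re : ℂ)) j = 0 := by
  rw [fourierCoeffOn_re_trigPoly]
  refine Finset.sum_eq_zero fun n _ => ?_
  have := n.2
  rw [if_neg (by omega), if_neg (by omega)]
  ring

theorem fourierCoeffOn_re_trigPoly_succ (hT : 0 < T) (z : Fin N → ℂ) (n : Fin N) :
    fourierCoeffOn hT (fun t => ((trigPoly T z t).re : ℂ)) ((n : ℤ) + 1) = z n / 2 := by
  rw [fourierCoeffOn_re_trigPoly, Finset.sum_eq_single n]
  · rw [if_pos rfl, if_neg (by omega)]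
    ring
  · intro l _ hl
    have : (l : ℕ) ≠ n := fun h => hl (Fin.ext h)
    rw [if_neg (by omega), if_neg (by omega)]
    ring
  · simp

/-! ### The index of the form in the rotating frame -/

theorem mem_H1T_of_contDiff (hT : 0 < T) {q : ℝ → ℂ} (hq : ContDiff ℝ 1 q)
    (hp : Function.Periodic q T) : q ∈ H1T T := by
  refine ⟨hp, hq.contDiffOn.absolutelyContinuousOnInterval, ?_⟩
  rw [uIoc_of_le hT.le]
  exact memLp_of_continuousOn (hq.continuous_deriv le_rfl).continuousOn

variable {u : ℂ} {w : ℝ} {k : ℕ}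

/-- The variations `frame u w • (f + i g)` whose radial component `f` is a trigonometric polynomial
with modes `1, …, N`, and whose tangential component is chosen to satisfy `g' + K f = 0`. -/
noncomputable def trigVariation (hT : 0 < T) (hwT : w * T = 2 * Real.pi * k) (u : ℂ) (K : ℝ)
    (N : ℕ) : (Fin N → ℂ) →ₗ[ℝ] H1T T where
  toFun z := ⟨fun t => frame u w t * (((trigPoly T z t).re : ℂ)
      + ((-K * (trigPoly T (primCoeff T z) t).re : ℝ) : ℂ) * Complex.I), by
    refine mem_H1T_of_contDiff hT ?_ fun t => ?_
    · have h : ∀ z : Fin N → ℂ, ContDiff ℝ 1 (fun t => (trigPoly T z t).re) := fun z =>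
        Complex.reCLM.contDiff.comp (contDiff_trigPoly z)
      exact contDiff_frame.mul ((Complex.ofRealCLM.contDiff.comp (h z)).add
        ((Complex.ofRealCLM.contDiff.comp (contDiff_const.mul (h _))).mul contDiff_const))
    · rw [periodic_frame hwT, periodic_trigPoly hT, periodic_trigPoly hT]⟩
  map_add' z z' := by
    refine Subtype.ext (funext fun t => ?_)
    simp only [Submodule.coe_add, Pi.add_apply, trigPoly_add, primCoeff_add, Complex.add_re]
    push_cast
    ring
  map_smul' a z := by
    refine Subtype.ext (funext fun t => ?_)
    simp only [Submodule.coe_smul, Pi.smul_apply, trigPoly_smul, primCoeff_smul,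
      Complex.re_ofReal_mul, Complex.real_smul, RingHom.id_apply]
    push_cast
    ring

variable (hT : 0 < T) (hwT : w * T = 2 * Real.pi * k) {K : ℝ}

theorem conj_frame_mul_trigVariation (hu : ‖u‖ = 1) (z : Fin N → ℂ) (t : ℝ) :
    (starRingEnd ℂ) (frame u w t) * (trigVariation hT hwT u K N z).1 t
      = ((trigPoly T z t).re : ℂ)
        + ((-K * (trigPoly T (primCoeff T z) t).re : ℝ) : ℂ) * Complex.I := by
  change (starRingEnd ℂ) (frame u w t) * (frame u w t * _) = _
  rw [← mul_assoc, conj_mul_self_of_norm_one (norm_frame hu t), one_mul]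

theorem radial_trigVariation (hu : ‖u‖ = 1) (z : Fin N → ℂ) :
    radial u w (trigVariation hT hwT u K N z).1 = fun t => (trigPoly T z t).re := by
  funext t
  rw [radial, conj_frame_mul_trigVariation hT hwT hu]
  simp

theorem deriv_tangential_trigVariation (hu : ‖u‖ = 1) (z : Fin N → ℂ) (t : ℝ) :
    deriv (tangential u w (trigVariation hT hwT u K N z).1) t = -K * (trigPoly T z t).re := by
  have : tangential u w (trigVariation hT hwT u K N z).1
      = fun t => -K * (trigPoly T (primCoeff T z) t).re := by
    funext t
    rw [tangential, conj_frame_mul_trigVariation hT hwT hu]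
    simp
  rw [this]
  exact ((hasDerivAt_re (hasDerivAt_trigPoly_primCoeff hT z t)).const_mul _).deriv

theorem fourierCoeffOn_radial_trigVariation (hu : ‖u‖ = 1) (z : Fin N → ℂ) (n : Fin N) :
    fourierCoeffOn hT (fun t => (radial u w (trigVariation hT hwT u K N z).1 t : ℂ)) ((n : ℤ) + 1)
      = z n / 2 := by
  rw [radial_trigVariation hT hwT hu]
  exact fourierCoeffOn_re_trigPoly_succ hT z n

theorem trigVariation_injective (hu : ‖u‖ = 1) :
    Function.Injective (trigVariation hT hwT u K N) := by
  rw [← LinearMap.ker_eq_bot, LinearMap.ker_eq_bot']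
  intro z hz
  funext n
  have h := fourierCoeffOn_radial_trigVariation hT hwT (K := K) hu z n
  rw [hz] at h
  have h0 : fourierCoeffOn hT (fun t => (radial u w (0 : H1T T).1 t : ℂ)) ((n : ℤ) + 1) = 0 := by
    simp [fourierCoeffOn_eq_integral, radial]
  rw [h0] at h
  simpa using h.symm

/-- The Fourier coefficients `1, …, N` of the radial component. -/
noncomputable def radialCoeffs (u : ℂ) (w : ℝ) (N : ℕ) : H1T T →ₗ[ℝ] (Fin N → ℂ) where
  toFun q n := fourierCoeffOn hT (fun t => (radial u w q.1 t : ℂ)) ((n : ℤ) + 1)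
  map_add' p q := by
    funext n
    have hi : ∀ q : H1T T, IntervalIntegrable (fun t : ℝ =>
        (fourier (-((n : ℤ) + 1)) (t : AddCircle (T - 0)) : ℂ) * (radial u w q.1 t : ℂ))
        volume 0 T := by
      intro q
      have h1 : Continuous (fun t : ℝ =>
          (fourier (-((n : ℤ) + 1)) (t : AddCircle (T - 0)) : ℂ)) :=
        (fourier _).continuous.comp (AddCircle.continuous_mk' _)
      refine (h1.continuousOn.mul
        (Complex.continuous_ofReal.comp_continuousOn ?_)).intervalIntegrable
      exact (absolutelyContinuous_re (absolutelyContinuous_conj_frame_mul q.2.2.1)).continuousOn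
    have hadd : ∀ t, (radial u w (p + q : H1T T).1 t : ℂ) = radial u w p.1 t + radial u w q.1 t := by
      intro t
      simp [radial, mul_add, sub_eq_add_neg]
    simp only [fourierCoeffOn_eq_integral, Pi.add_apply, hadd, smul_eq_mul, mul_add]
    rw [intervalIntegral.integral_add (hi p) (hi q), smul_add]
  map_smul' a q := by
    funext n
    have : (fun t => (radial u w (a • q : H1T T).1 t : ℂ))
        = fun t => (a : ℂ) * (radial u w q.1 t : ℂ) := by
      funext t
      simp [radial]
      ring
    simp only [this, fourierCoeffOn.const_mul, RingHom.id_apply, Pi.smul_apply, Complex.real_smul]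

theorem rank_fin_complex (N : ℕ) : Module.rank ℝ (Fin N → ℂ) = ((2 * N : ℕ) : Cardinal) := by
  rw [← Module.finrank_eq_rank, Module.finrank_pi_fintype]
  simp [Complex.finrank_real_complex, mul_comm]

/-- A form which is negative definite on an injective image of `V'`, and nonnegative on the kernel of
a linear map to `V'`, has index `dim V'`. -/
theorem morseIndex_eq {V V' : Type} [AddCommGroup V] [Module ℝ V] [AddCommGroup V'] [Module ℝ V']
    {Q : V → ℝ} (A : V' →ₗ[ℝ] V) (hA : Function.Injective A) (hneg : ∀ z, z ≠ 0 → Q (A z) < 0)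
    (B : V →ₗ[ℝ] V') (hB : ∀ q, B q = 0 → 0 ≤ Q q) :
    morseIndex Q = Cardinal.toENat (Module.rank ℝ V') := by
  refine le_antisymm (iSup_le ?_) ?_
  · rintro ⟨W, hW⟩
    refine OrderHomClass.mono Cardinal.toENat ?_
    -- `B` is injective on `W`, since its kernel meets `W` only in `0`.
    refine LinearMap.rank_le_of_injective (B.comp W.subtype) ?_
    rw [← LinearMap.ker_eq_bot, LinearMap.ker_eq_bot']
    intro q hq
    by_contra hne
    have h1 := hW q q.2 (fun h => hne (Subtype.ext h))
    have h2 := hB q hq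
    linarith
  · have hr : Module.rank ℝ (LinearMap.range A) = Module.rank ℝ V' :=
      (LinearEquiv.ofInjective A hA).rank_eq.symm
    rw [← hr]
    refine le_iSup (fun W : {W : Submodule ℝ V // ∀ q ∈ W, q ≠ 0 → Q q < 0} =>
      Cardinal.toENat (Module.rank ℝ W.1)) ⟨LinearMap.range A, ?_⟩
    rintro _ ⟨z, rfl⟩ hq
    exact hneg z fun h => hq (by rw [h, map_zero])

/-- The index of a circular orbit with angular velocity `w` and Lorentz factor `G` is twice the number
of frequencies `2 π n / T`, `n ≥ 1`, below `w / G`. -/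
theorem orbitIndex_circular {m c α R G : ℝ} (hm : 0 < m) (hT : 0 < T) (hu : ‖u‖ = 1)
    (hR : 0 < R) (hw : 0 < w) (hG0 : 0 < G) (hG : lorentz c (R * w : ℝ) = G)
    (hrel : G ^ 2 * (1 - (R * w) ^ 2 / c ^ 2) = 1) (hbal : m * G * w ^ 2 * R ^ 3 = α)
    (hwT : w * T = 2 * Real.pi * k) {i : ℕ} (hi : i * (2 * Real.pi / T) < w / G)
    (hi' : w / G ≤ (i + 1) * (2 * Real.pi / T)) :
    orbitIndex m c α T (fun t => R * frame u w t) = ((2 * i : ℕ) : ℕ∞) := by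
  set s := w / G with hs
  set K := w * (G ^ 2 + 1) / G ^ 2 with hK
  have hs' : G * s = w := by rw [hs]; field_simp
  have hK' : G ^ 2 * K = w * (G ^ 2 + 1) := by rw [hK]; field_simp
  have hs0 : 0 ≤ s := by positivity
  have hsK : s ^ 2 ≤ G ^ 2 * K ^ 2 := by
    have e1 : s ^ 2 = w ^ 2 / G ^ 2 := by rw [hs, div_pow]
    have e2 : G ^ 2 * K ^ 2 = w ^ 2 * (G ^ 2 + 1) ^ 2 / G ^ 2 := by
      rw [hK]
      field_simp
    rw [e1, e2]
    gcongr
    have : 1 ≤ (G ^ 2 + 1) ^ 2 := one_le_pow₀ (by nlinarith)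
    exact le_mul_of_one_le_right (by positivity) this
  have hform := secondVariation_circular hT hu hR hG0 hG hrel hbal hK' hs' hwT
  have hmG : 0 < m * G / 2 := by positivity
  rw [orbitIndex, morseIndex_eq (trigVariation hT hwT u K i) (trigVariation_injective hT hwT hu) ?_
    (radialCoeffs hT u w i) ?_, rank_fin_complex]
  · simp
  · intro z hz
    obtain ⟨n, hn⟩ := Function.ne_iff.1 hz
    have hf := isH1Loop_radial hT hu hwT (trigVariation hT hwT u K i z).2
    rw [hform]
    refine mul_neg_of_pos_of_neg hmG ?_
    have hlt := integral_wirtinger_neg hT hf hi (j := (n : ℤ) + 1) (fun l hl => by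
        rw [radial_trigVariation hT hwT hu]
        exact fourierCoeffOn_re_trigPoly_eq_zero hT z hl) (by
        rw [fourierCoeffOn_radial_trigVariation hT hwT hu]
        exact div_ne_zero hn two_ne_zero)
    refine lt_of_eq_of_lt (intervalIntegral.integral_congr fun t _ => ?_) hlt
    simp only [deriv_tangential_trigVariation hT hwT hu]
    rw [radial_trigVariation hT hwT hu]
    ring
  · intro q hq
    rw [hform]
    refine mul_nonneg hmG.le ?_
    exact integral_rotating_nonneg hT (isH1Loop_radial hT hu hwT q.2)
      (isH1Loop_tangential hT hu hwT q.2) hs0 hsK hi' fun n => congrFun hq n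

end RelKepler

namespace RelKepler

/-! ### Circular solutions -/

/-- `R` is the radius of a circular orbit with angular velocity `w` and Lorentz factor `G`. The field
`balance` is the equation of motion. -/
structure IsOrbitRadius (m c α w R G : ℝ) : Prop where
  radius_pos : 0 < R
  lorentz_pos : 0 < G
  lorentz_eq : lorentz c (R * w : ℝ) = G
  lorentz_sq : G ^ 2 * (1 - (R * w) ^ 2 / c ^ 2) = 1
  balance : m * G * w ^ 2 * R ^ 3 = α

variable {m c α T w : ℝ} {k : ℕ}

theorem one_sub_sq_div_pos (hc : 0 < c) {v : ℂ} (hv : ‖v‖ < c) : 0 < 1 - ‖v‖ ^ 2 / c ^ 2 := by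
  have h : ‖v‖ ^ 2 < c ^ 2 := pow_lt_pow_left₀ hv (norm_nonneg v) two_ne_zero
  rw [sub_pos, div_lt_one (by positivity)]
  exact h

theorem lorentz_pos (hc : 0 < c) {v : ℂ} (hv : ‖v‖ < c) : 0 < lorentz c v :=
  inv_pos.2 (Real.sqrt_pos.2 (one_sub_sq_div_pos hc hv))

theorem lorentz_sq_mul (hc : 0 < c) {v : ℂ} (hv : ‖v‖ < c) :
    lorentz c v ^ 2 * (1 - ‖v‖ ^ 2 / c ^ 2) = 1 := by
  have h := one_sub_sq_div_pos hc hv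
  rw [lorentz, inv_pow, Real.sq_sqrt h.le, inv_mul_cancel₀ h.ne']

/-- The radius of a circular orbit of given angular velocity exists by the intermediate value
theorem: the gravitational and centrifugal forces balance somewhere between the centre and the radius
`c / w` at which the speed of light is reached. -/
theorem exists_isOrbitRadius (hm : 0 < m) (hc : 0 < c) (hα : 0 < α) (hw : 0 < w) :
    ∃ R G, IsOrbitRadius m c α w R G ∧ R * w < c := by
  set F : ℝ → ℝ := fun R => m * w ^ 2 * R ^ 3 - α * √(1 - (R * w) ^ 2 / c ^ 2) with hF
  have hcont : ContinuousOn F (Icc 0 (c / w)) := by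
    refine Continuous.continuousOn ?_
    fun_prop
  have h0 : F 0 < 0 := by simp [hF, hα]
  have h1 : 0 < F (c / w) := by
    have : c / w * w = c := by field_simp
    simp only [hF, this, div_self (pow_ne_zero 2 hc.ne'), sub_self, Real.sqrt_zero, mul_zero,
      sub_zero]
    positivity
  obtain ⟨R, ⟨hR0, hR1⟩, hR⟩ := intermediate_value_Icc (by positivity) hcont
    (show (0 : ℝ) ∈ Icc (F 0) (F (c / w)) from ⟨h0.le, h1.le⟩)
  have hRpos : 0 < R := hR0.lt_of_ne fun h => by
    rw [← h] at hR
    exact h0.ne hR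
  have hRlt : R < c / w := hR1.lt_of_ne fun h => by
    rw [h] at hR
    exact h1.ne' hR
  have hRw : R * w < c := (lt_div_iff₀ hw).1 hRlt
  have hn : ‖((R * w : ℝ) : ℂ)‖ = R * w := by
    rw [Complex.norm_real, Real.norm_eq_abs, abs_of_pos (by positivity)]
  have hv : ‖((R * w : ℝ) : ℂ)‖ < c := hn.trans_lt hRw
  have hG := lorentz_pos hc hv
  have hG2 := lorentz_sq_mul hc hv
  rw [hn] at hG2
  refine ⟨R, lorentz c (R * w : ℝ), ⟨hRpos, hG, rfl, hG2, ?_⟩, hRw⟩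
  have e : lorentz c (R * w : ℝ) * √(1 - (R * w) ^ 2 / c ^ 2) = 1 := by
    rw [lorentz, hn]
    refine inv_mul_cancel₀ (Real.sqrt_pos.2 ?_).ne'
    have := one_sub_sq_div_pos hc hv
    rwa [hn] at this
  simp only [hF] at hR
  linear_combination (lorentz c (R * w : ℝ)) * hR + α * e

theorem isCircularSolution_frame (hw : 0 < w) (hwT : w * T = 2 * Real.pi * k)
    {R G : ℝ} (h : IsOrbitRadius m c α w R G) (hRw : R * w < c) :
    IsCircularSolution m c α T k (fun t => R * frame 1 w t) := by
  have hR := h.radius_pos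
  have hu : ‖(1 : ℂ)‖ = 1 := norm_one
  have hd : ∀ t, HasDerivAt (fun t => (R : ℂ) * frame 1 w t) (R * (w * Complex.I * frame 1 w t)) t :=
    fun t => (hasDerivAt_frame t).const_mul _
  have hd' : deriv (fun t => (R : ℂ) * frame 1 w t) = fun t => R * (w * Complex.I * frame 1 w t) :=
    funext fun t => (hd t).deriv
  have hn : ∀ t, ‖(R : ℂ) * frame 1 w t‖ = R := fun t => by simp [norm_frame, abs_of_pos hR]
  have hnv : ∀ t, ‖(R : ℂ) * (w * Complex.I * frame 1 w t)‖ = ‖((R * w : ℝ) : ℂ)‖ := fun t => by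
    simp [norm_frame]
  refine ⟨⟨fun t => (hd t).differentiableAt, fun t => ?_, fun t => ?_, fun t => ?_⟩, fun t => ?_,
    ⟨R, hn⟩, ?_⟩
  · rw [← norm_pos_iff, hn]
    exact hR
  · rw [hd', hnv, Complex.norm_real, Real.norm_eq_abs, abs_of_pos (by positivity)]
    exact hRw
  · simp only [hd', lorentz_congr (hnv _), h.lorentz_eq, hn]
    have h1 := (((hasDerivAt_frame (u := 1) (w := w) t).const_mul (w * Complex.I)).const_mul
      (R : ℂ)).const_smul (m * G)
    refine h1.congr_deriv ?_
    have h2 : α / R ^ 3 = m * G * w ^ 2 := by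
      rw [← h.balance]
      field_simp
    rw [h2]
    simp only [Complex.real_smul]
    push_cast
    linear_combination (m * G * R * w ^ 2 * frame 1 w t) * Complex.I_sq
  · simp only [periodic_frame hwT t]
  · have : ∀ t, (((R : ℂ) * frame 1 w t).re * (deriv (fun t => (R : ℂ) * frame 1 w t) t).im
        - ((R : ℂ) * frame 1 w t).im * (deriv (fun t => (R : ℂ) * frame 1 w t) t).re)
        / (((R : ℂ) * frame 1 w t).re ^ 2 + ((R : ℂ) * frame 1 w t).im ^ 2) = w := by
      intro t
      have hne : ((R : ℂ) * frame 1 w t).re ^ 2 + ((R : ℂ) * frame 1 w t).im ^ 2 ≠ 0 := by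
        have := Complex.sq_norm ((R : ℂ) * frame 1 w t)
        rw [hn, Complex.normSq_apply] at this
        have hR2 : 0 < R ^ 2 := by positivity
        nlinarith
      rw [div_eq_iff hne, hd']
      simp
      ring
    simp only [windingNumber, this, intervalIntegral.integral_const, smul_eq_mul, sub_zero]
    rw [mul_comm T, hwT]
    field_simp

/-- Every circular solution moves uniformly: the momentum is orthogonal to the force, so the speed is
constant; then the angular momentum is constant, and the winding number determines the angular
velocity. -/
theorem IsCircularSolution.exists_frame (hm : 0 < m) (hc : 0 < c) (hT : 0 < T)
    (hwT : w * T = 2 * Real.pi * k) {x : ℝ → ℂ} (hx : IsCircularSolution m c α T k x) :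
    ∃ u R G, ‖u‖ = 1 ∧ IsOrbitRadius m c α w R G ∧ x = fun t => R * frame u w t := by
  obtain ⟨⟨hdiff, hne, hspeed, heqn⟩, -, ⟨R, hR⟩, hwind⟩ := hx
  have hRpos : 0 < R := hR 0 ▸ norm_pos_iff.2 (hne 0)
  have hxd : ∀ t, HasDerivAt x (deriv x t) t := fun t => (hdiff t).hasDerivAt
  have horth : ∀ t, inner ℝ (x t) (deriv x t) = 0 := by
    intro t
    have h1 := (hxd t).norm_sq
    have h2 : (fun t => ‖x t‖ ^ 2) = fun _ => R ^ 2 := funext fun t => by rw [hR]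
    rw [h2] at h1
    have := h1.unique (hasDerivAt_const t _)
    linarith
  have hlpos : ∀ t, 0 < lorentz c (deriv x t) := fun t => lorentz_pos hc (hspeed t)
  have hlsq : ∀ t, lorentz c (deriv x t) ^ 2 * (1 - ‖deriv x t‖ ^ 2 / c ^ 2) = 1 :=
    fun t => lorentz_sq_mul hc (hspeed t)
  simp only [hR] at heqn
  -- The momentum has constant norm, being orthogonal to the force.
  have hmom : ∀ t, ‖(m * lorentz c (deriv x t)) • deriv x t‖ ^ 2
      = ‖(m * lorentz c (deriv x 0)) • deriv x 0‖ ^ 2 := by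
    intro t
    refine is_const_of_deriv_eq_zero (fun s => ((heqn s).norm_sq).differentiableAt) (fun s => ?_) t 0
    rw [((heqn s).norm_sq).deriv, real_inner_smul_left, real_inner_smul_right, real_inner_comm,
      horth s]
    ring
  -- The norm of the momentum determines the Lorentz factor.
  have hG : ∀ t, lorentz c (deriv x t) = lorentz c (deriv x 0) := by
    intro t
    have h := hmom t
    simp only [norm_smul, Real.norm_eq_abs, mul_pow, sq_abs] at h
    have h' : lorentz c (deriv x t) ^ 2 * ‖deriv x t‖ ^ 2
        = lorentz c (deriv x 0) ^ 2 * ‖deriv x 0‖ ^ 2 := by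
      have hm2 : m ^ 2 ≠ 0 := by positivity
      refine mul_left_cancel₀ hm2 ?_
      linear_combination h
    have h2 : lorentz c (deriv x t) ^ 2 = lorentz c (deriv x 0) ^ 2 := by
      linear_combination hlsq t - hlsq 0 + (1 / c ^ 2) * h'
    exact (pow_left_inj₀ (hlpos t).le (hlpos 0).le two_ne_zero).1 h2
  set G := lorentz c (deriv x 0) with hGdef
  have hGpos : 0 < G := hlpos 0
  have hmG : m * G ≠ 0 := by positivity
  have hacc : ∀ t, HasDerivAt (deriv x) (-(α / (R ^ 3 * (m * G))) • x t) t := by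
    intro t
    have h := (heqn t).const_smul (m * G)⁻¹
    simp only [hG] at h
    have e : (fun s => deriv x s) = (m * G)⁻¹ • fun s => (m * G) • deriv x s := by
      funext s
      rw [Pi.smul_apply, smul_smul, inv_mul_cancel₀ hmG, one_smul]
    have h' : HasDerivAt (fun s => deriv x s) _ t := e ▸ h
    refine h'.congr_deriv ?_
    rw [smul_smul]
    congr 1
    field_simp
  -- `L` is the angular momentum, up to the constant factor `m G`.
  set L : ℝ → ℝ := fun t => (x t).re * (deriv x t).im - (x t).im * (deriv x t).re with hL
  have hLconst : ∀ t, L t = L 0 := by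
    have hLd : ∀ s, HasDerivAt L 0 s := by
      intro s
      have h := ((hasDerivAt_re (hxd s)).mul (hasDerivAt_im (hacc s))).sub
        ((hasDerivAt_im (hxd s)).mul (hasDerivAt_re (hacc s)))
      refine h.congr_deriv ?_
      simp only [Complex.smul_re, Complex.smul_im, smul_eq_mul]
      ring
    intro t
    exact is_const_of_deriv_eq_zero (fun s => (hLd s).differentiableAt) (fun s => (hLd s).deriv) t 0
  have hsq : ∀ t, (x t).re ^ 2 + (x t).im ^ 2 = R ^ 2 := by
    intro t
    have := Complex.sq_norm (x t)
    rw [hR, Complex.normSq_apply] at this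
    linear_combination -this
  have hLw : L 0 = R ^ 2 * w := by
    have e : ∀ t, ((x t).re * (deriv x t).im - (x t).im * (deriv x t).re)
        / ((x t).re ^ 2 + (x t).im ^ 2) = L 0 / R ^ 2 := fun t => by
      rw [hsq, ← hLconst t]
    simp only [windingNumber, e, intervalIntegral.integral_const, smul_eq_mul, sub_zero] at hwind
    have h1 : T * (L 0 / R ^ 2) = T * w := by
      rw [mul_comm T w, hwT, ← hwind]
      field_simp
    have h2 := mul_left_cancel₀ hT.ne' h1
    rw [div_eq_iff (by positivity)] at h2
    linarith
  have hv : ∀ t, deriv x t = w * Complex.I * x t := by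
    intro t
    have h1 := horth t
    have h2 : L t = R ^ 2 * w := (hLconst t).trans hLw
    have h3 := hsq t
    have hR2 : R ^ 2 ≠ 0 := by positivity
    rw [Complex.inner] at h1
    simp only [Complex.mul_re, Complex.conj_re, Complex.conj_im] at h1
    simp only [hL] at h2
    have hwre : ((w : ℂ) * Complex.I * x t).re = -(w * (x t).im) := by simp
    have hwim : ((w : ℂ) * Complex.I * x t).im = w * (x t).re := by simp
    refine Complex.ext ?_ ?_
    · refine mul_left_cancel₀ hR2 ?_
      rw [hwre]
      linear_combination (-(deriv x t).re) * h3 + (x t).re * h1 - (x t).im * h2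
    · refine mul_left_cancel₀ hR2 ?_
      rw [hwim]
      linear_combination (-(deriv x t).im) * h3 + (x t).im * h1 + (x t).re * h2
  have hnorm : ∀ t, ‖deriv x t‖ = ‖((R * w : ℝ) : ℂ)‖ := by
    intro t
    rw [hv]
    simp [hR, abs_of_pos hRpos, mul_comm]
  have hform : ∀ t, x t = x 0 * Complex.exp ((w * t : ℝ) * Complex.I) := by
    have hd : ∀ t, HasDerivAt (fun s => x s * frame 1 (-w) s) 0 t := by
      intro t
      refine ((hxd t).mul (hasDerivAt_frame t)).congr_deriv ?_
      rw [hv]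
      push_cast
      ring
    intro t
    have h := is_const_of_deriv_eq_zero (fun s => (hd s).differentiableAt) (fun s => (hd s).deriv) t 0
    simp only [frame, one_mul, mul_zero, Complex.ofReal_zero, zero_mul, Complex.exp_zero,
      mul_one] at h
    rw [← h, mul_assoc, ← Complex.exp_add]
    simp
  have hn2 : ‖((R * w : ℝ) : ℂ)‖ ^ 2 = (R * w) ^ 2 := by
    rw [Complex.norm_real, Real.norm_eq_abs, sq_abs]
  have hRC : (R : ℂ) ≠ 0 := by exact_mod_cast hRpos.ne'
  refine ⟨x 0 / R, R, G, ?_, ⟨hRpos, hGpos, ?_, ?_, ?_⟩, ?_⟩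
  · rw [norm_div, hR, Complex.norm_real, Real.norm_eq_abs, abs_of_pos hRpos, div_self hRpos.ne']
  · exact lorentz_congr (hnorm 0).symm
  · have := hlsq 0
    rwa [hnorm, hn2] at this
  · -- Compare the acceleration `- w² x` of the uniform rotation with the force.
    have h1 := (hasDerivAt_frame (u := x 0) (w := w) 0).const_mul (w * Complex.I)
    have h2 : deriv x = fun t => w * Complex.I * frame (x 0) w t :=
      funext fun t => by rw [hv, hform t, frame]
    have h3 := hacc 0
    rw [h2] at h3
    have h4 := h3.unique h1
    have h5 : frame (x 0) w 0 = x 0 := by simp [frame]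
    rw [h5, Complex.real_smul] at h4
    have h6 : ((α / (R ^ 3 * (m * G)) : ℝ) : ℂ) = ((w ^ 2 : ℝ) : ℂ) := by
      refine mul_right_cancel₀ (hne 0) ?_
      push_cast at h4 ⊢
      linear_combination -h4 - w ^ 2 * x 0 * Complex.I_sq
    have h7 := Complex.ofReal_injective h6
    rw [div_eq_iff (by positivity)] at h7
    linarith
  · funext t
    rw [hform t, frame]
    field_simp

/-! ### The thresholds -/

/-- For `1 ≤ n < k`, the `n`-th threshold is the period at which the Lorentz factor of the orbit is
`k / n`. -/
theorem threshold_lt_iff (hm : 0 < m) (hc : 0 < c) (hT : 0 < T) (hw : 0 < w)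
    (hk : 0 < k) (hwT : w * T = 2 * Real.pi * k) {R G : ℝ} (h : IsOrbitRadius m c α w R G) (n : ℕ) :
    threshold m c α k n < (T : EReal) ↔ n * G < k := by
  obtain ⟨hR, hG, -, hsq, hbal⟩ := h
  have hk' : (0 : ℝ) < k := by exact_mod_cast hk
  -- `b` is the speed in units of `c`; below, `n G < k` is compared with `k b < d`.
  set b := R * w / c with hb
  have hb0 : 0 < b := by positivity
  have hGb : G ^ 2 * b ^ 2 = G ^ 2 - 1 := by
    rw [hb, div_pow]
    linear_combination -hsq
  have hG1 : 1 ≤ G := by nlinarith [mul_pos (pow_pos hG 2) (pow_pos hb0 2)]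
  have hα' : m * c ^ 3 * (G * b ^ 3) = α * w := by
    rw [← hbal, hb]
    field_simp
  by_cases hn : n < k
  · have hn' : (n : ℝ) < k := by exact_mod_cast hn
    have hn0 : (0 : ℝ) ≤ n := Nat.cast_nonneg n
    have hd : (0 : ℝ) < (k : ℝ) ^ 2 - (n : ℝ) ^ 2 := by nlinarith
    set d := √((k : ℝ) ^ 2 - (n : ℝ) ^ 2) with hdd
    have hd0 : 0 < d := Real.sqrt_pos.2 hd
    have hd2 : d ^ 2 = (k : ℝ) ^ 2 - (n : ℝ) ^ 2 := Real.sq_sqrt hd.le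
    have hpow : ((k : ℝ) ^ 2 - (n : ℝ) ^ 2) ^ (3 / 2 : ℝ) = d ^ 3 := by
      rw [hdd, Real.sqrt_eq_rpow, ← Real.rpow_natCast (_ ^ (1 / 2 : ℝ)), ← Real.rpow_mul hd.le]
      norm_num
    have hC : 2 * Real.pi * α / (m * c ^ 3) = T * (G * b ^ 3) / k := by
      rw [div_eq_div_iff (by positivity) (by positivity)]
      linear_combination (-T) * hα' - α * hwT
    have hthr : (n : ℝ) * (k : ℝ) ^ 3 / d ^ 3 * (2 * Real.pi * α / (m * c ^ 3))
        = T * (n * G * k ^ 2 * b ^ 3 / d ^ 3) := by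
      rw [hC]
      field_simp
    rw [threshold, if_pos hn, hpow, hthr, EReal.coe_lt_coe_iff, mul_lt_iff_lt_one_right hT,
      div_lt_one (by positivity)]
    have hkd : G ^ 2 * ((k * b) ^ 2 - d ^ 2) = (n * G) ^ 2 - k ^ 2 := by
      rw [hd2]
      linear_combination (k : ℝ) ^ 2 * hGb
    constructor
    · contrapose!
      intro hle
      have h1 : (k : ℝ) ^ 2 ≤ (n * G) ^ 2 := pow_le_pow_left₀ hk'.le hle 2
      have h2 : d ≤ k * b := by
        refine le_of_sq_le_sq ?_ (by positivity)
        have : 0 ≤ (k * b) ^ 2 - d ^ 2 :=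
          nonneg_of_mul_nonneg_right (by rw [hkd]; linarith) (by positivity : 0 < G ^ 2)
        linarith
      calc d ^ 3 ≤ (k * b) ^ 3 := pow_le_pow_left₀ hd0.le h2 3
        _ = k * (k ^ 2 * b ^ 3) := by ring
        _ ≤ n * G * (k ^ 2 * b ^ 3) := by gcongr
        _ = n * G * k ^ 2 * b ^ 3 := by ring
    · intro hlt
      have h1 : (n * G) ^ 2 < (k : ℝ) ^ 2 := pow_lt_pow_left₀ hlt (by positivity) two_ne_zero
      have h2 : k * b < d := by
        refine lt_of_pow_lt_pow_left₀ 2 hd0.le ?_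
        have : (k * b) ^ 2 - d ^ 2 < 0 :=
          neg_of_mul_neg_right (a := G ^ 2) (by rw [hkd]; linarith) (by positivity)
        linarith
      calc n * G * k ^ 2 * b ^ 3 = n * G * (k ^ 2 * b ^ 3) := by ring
        _ ≤ k * (k ^ 2 * b ^ 3) := by gcongr
        _ = (k * b) ^ 3 := by ring
        _ < d ^ 3 := pow_lt_pow_left₀ h2 (by positivity) (by norm_num)
  · rw [threshold, if_neg hn]
    have hn' : (k : ℝ) ≤ n := by exact_mod_cast not_lt.1 hn
    refine iff_of_false not_top_lt (not_lt.2 ?_)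
    nlinarith

end RelKepler

theorem mainTheorem4 (m c α T : ℝ) (hm : 0 < m) (hc : 0 < c) (hα : 0 < α) (hT : 0 < T)
    (k i : ℕ) (hk : 1 ≤ k) (hi : i < k)
    (hlow : RelKepler.threshold m c α k i < (T : EReal))
    (hupp : (T : EReal) ≤ RelKepler.threshold m c α k (i + 1)) :
    (∃ x : ℝ → ℂ, RelKepler.IsCircularSolution m c α T k x) ∧
      ∀ x : ℝ → ℂ, RelKepler.IsCircularSolution m c α T k x →
        RelKepler.orbitIndex m c α T x = ((2 * i : ℕ) : ℕ∞) := by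
  have hk' : (0 : ℝ) < k := by exact_mod_cast hk
  obtain ⟨w, hw, hwT⟩ : ∃ w : ℝ, 0 < w ∧ w * T = 2 * Real.pi * k :=
    ⟨2 * Real.pi * k / T, by positivity, by field_simp⟩
  constructor
  · obtain ⟨R, G, h, hRw⟩ := RelKepler.exists_isOrbitRadius hm hc hα hw
    exact ⟨_, RelKepler.isCircularSolution_frame hw hwT h hRw⟩
  · intro x hx
    obtain ⟨u, R, G, hu, h, rfl⟩ := hx.exists_frame hm hc hT hwT
    have h1 := (RelKepler.threshold_lt_iff hm hc hT hw hk hwT h i).1 hlow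
    have h2 := mt (RelKepler.threshold_lt_iff hm hc hT hw hk hwT h (i + 1)).2 hupp.not_gt
    have hG := h.lorentz_pos
    have hwk : w / G = k / G * (2 * Real.pi / T) := by
      rw [eq_div_of_mul_eq hT.ne' hwT]
      ring
    refine RelKepler.orbitIndex_circular hm hT hu h.radius_pos hw hG h.lorentz_eq h.lorentz_sq
      h.balance hwT ?_ ?_
    · rw [hwk]
      gcongr
      exact (lt_div_iff₀ hG).2 h1
    · rw [hwk]
      gcongr
      rw [div_le_iff₀ hG]
      push_cast at h2
      exact not_lt.1 h2
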